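/- Let $T\ge 2$, $N,m\in\mathbb N$, $R\in\mathbb R^{T\times N}$ and $\epsilon>0$. Put $$p:=\tfrac1T R^\top\mathbf 1_T,\qquad Q:=\tfrac1{\sqrt{T-1}}\bigl(R-\tfrac1T\mathbf 1_{T\times T}R\bigr),\qquad Q_\epsilon:=Q^\top Q+\epsilon I,$$ $$\Omega:=\{v\in\mathbb R^N : v\ge 0,\ \|v\|_0\le m\},\qquad f(v):=\tfrac12 v^\top Q_\epsilon v-p^\top v,\qquad S(w):=\frac{p^\top w}{\sqrt{w^\top Q_\epsilon w}},$$ where $\|v\|_0$ is the number of nonzero components of $v$. Let $\iota_\Omega$ be $0$ on $\Omega$ and $+\infty$ off $\Omega$, and let $\mathrm{prox}_{\iota_\Omega}(x)$ be the set of all minimizers of $u\mapsto\frac12\|u-x\|_2^2+\iota_\Omega(u)$ over $\mathbb R^N$. A point $v^*\in\Omega$ is a locally optimal solution of $\min_{v\in\Omega}f(v)$ if for some $\delta>0$ one has $f(v^*)\le f(v)$ for all $v\in\Omega$ with $\|v-v^*\|_2<\delta$. Suppose that there is some $\tilde w\in\Omega$ with $p^\top\tilde w>0$, and let $\alpha\in(0,1/\|Q_\epsilon\|_2)$,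 where $\|\cdot\|_2$ of a matrix is the spectral norm. Let $v^{(0)}\in\mathbb R^N$ be arbitrary and let $(v^{(k)})_{k\in\mathbb N}$ be any sequence generated by the proximal gradient algorithm $$v^{(k+1)}\in\mathrm{prox}_{\iota_\Omega}\bigl(v^{(k)}-\alpha\nabla f(v^{(k)})\bigr),\qquad k\in\mathbb N .$$ Let $w^{(k)}:=v^{(k)}/(\mathbf 1^\top v^{(k)})$ if $\mathbf 1^\top v^{(k)}\ne0$, and $w^{(k)}:=0$ otherwise. Then, as $k\to\infty$: (i) $(v^{(k)})$ converges to a locally optimal solution $v^*$ of $\min_{v\in\Omega}f(v)$, with $\|v^{(k)}-v^*\|_2=O(1/\sqrt k)$ and $|f(v^{(k)})-f(v^*)|=O(1/k)$; (ii) $v^*\ge 0$ and $v^*\ne 0$; (iii) $(w^{(k)})$ converges to $w^*:=v^*/(\mathbf 1^\top v^*)$, with $\|w^{(k)}-w^*\|_2=O(1/\sqrt k)$ and $|S(w^{(k)})-S(w^*)|=O(1/\sqrt k)$. -/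

import Mathlib

open Filter Topology Asymptotics
open scoped Matrix

namespace SparseSharpe

noncomputable section

variable {T N : ℕ}

/-- The vector of sample mean returns, `p = (1/T) Rᵀ 1`. -/
def meanReturn (R : Matrix (Fin T) (Fin N) ℝ) : Fin N → ℝ :=
  (1 / (T : ℝ)) • (Rᵀ *ᵥ (fun _ => 1))

/-- The scaled centered return matrix, `Q = (T-1)^{-1/2} (R - (1/T) 1_{T×T} R)`. -/
def centered (R : Matrix (Fin T) (Fin N) ℝ) : Matrix (Fin T) (Fin N) ℝ :=
  (1 / √((T : ℝ) - 1)) •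
    (R - (1 / (T : ℝ)) • ((Matrix.of fun _ _ => 1 : Matrix (Fin T) (Fin T) ℝ) * R))

/-- The regularized covariance matrix, `Q_ε = Qᵀ Q + ε I`. -/
def covReg (R : Matrix (Fin T) (Fin N) ℝ) (ε : ℝ) : Matrix (Fin N) (Fin N) ℝ :=
  (centered R)ᵀ * centered R + ε • (1 : Matrix (Fin N) (Fin N) ℝ)

/-- The spectral norm `‖A‖₂`: the operator norm for the Euclidean norm. -/
def spectralNorm (A : Matrix (Fin N) (Fin N) ℝ) : ℝ :=
  ‖Matrix.toEuclideanCLM (𝕜 := ℝ) A‖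

/-- The number of nonzero components, `‖v‖₀`. -/
def l0 (v : EuclideanSpace ℝ (Fin N)) : ℕ :=
  (Finset.univ.filter fun i => v i ≠ 0).card

/-- The constraint set `Ω` of nonnegative `m`-sparse vectors. -/
def feasible (N m : ℕ) : Set (EuclideanSpace ℝ (Fin N)) :=
  {v | (∀ i, 0 ≤ v i) ∧ l0 v ≤ m}

/-- The quadratic objective `f(v) = (1/2) vᵀ Q_ε v - pᵀ v`. -/
def objective (R : Matrix (Fin T) (Fin N) ℝ) (ε : ℝ) (v : EuclideanSpace ℝ (Fin N)) : ℝ :=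
  1 / 2 * (v.ofLp ⬝ᵥ (covReg R ε *ᵥ v.ofLp)) - meanReturn R ⬝ᵥ v.ofLp

/-- The Sharpe ratio `S(w) = pᵀ w / √(wᵀ Q_ε w)`. -/
def sharpe (R : Matrix (Fin T) (Fin N) ℝ) (ε : ℝ) (w : EuclideanSpace ℝ (Fin N)) : ℝ :=
  (meanReturn R ⬝ᵥ w.ofLp) / √(w.ofLp ⬝ᵥ (covReg R ε *ᵥ w.ofLp))

/-- The indicator function of a set, in the sense of optimization: `0` on the set and `+∞` off it. -/
def iota (C : Set (EuclideanSpace ℝ (Fin N))) (v : EuclideanSpace ℝ (Fin N)) : EReal :=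
  open Classical in if v ∈ C then 0 else ⊤

/-- The set-valued proximity operator:
all minimizers `h` of `u ↦ (1/2) ‖u - x‖² + ψ(u)`. -/
def prox (ψ : EuclideanSpace ℝ (Fin N) → EReal) (x : EuclideanSpace ℝ (Fin N)) :
    Set (EuclideanSpace ℝ (Fin N)) :=
  {h | ∀ u, ((1 / 2 * ‖h - x‖ ^ 2 : ℝ) : EReal) + ψ h ≤ ((1 / 2 * ‖u - x‖ ^ 2 : ℝ) : EReal) + ψ u}

/-- `v` is a sequence generated by the proximal gradient algorithm with step `α`, from the
arbitrary starting point `v 0`; each iterate may be any element of the proximity operator. -/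
def IsPGA (R : Matrix (Fin T) (Fin N) ℝ) (ε : ℝ) (m : ℕ) (α : ℝ)
    (v : ℕ → EuclideanSpace ℝ (Fin N)) : Prop :=
  ∀ k, v (k + 1) ∈ prox (iota (feasible N m)) (v k - α • gradient (objective R ε) (v k))

/-- `v` is a locally optimal solution of the `m`-sparse quadratic program
`min {f(v) : v ∈ Ω}`. -/
def IsLocallyOptimal (R : Matrix (Fin T) (Fin N) ℝ) (ε : ℝ) (m : ℕ)
    (v : EuclideanSpace ℝ (Fin N)) : Prop :=
  v ∈ feasible N m ∧ IsLocalMinOn (objective R ε) (feasible N m) v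

/-- The normalized portfolio: `v / (1ᵀ v)` if `1ᵀ v ≠ 0`, and `0` otherwise. -/
def normalize (v : EuclideanSpace ℝ (Fin N)) : EuclideanSpace ℝ (Fin N) :=
  if ∑ i, v i ≠ 0 then (1 / ∑ i, v i) • v else 0

end

end SparseSharpe

/-!
The feasible set `Ω` of nonnegative `m`-sparse vectors is a finite union of closed convex cones
`C_S`, one for each support `S` with at most `m` elements, and the objective `f` is a strongly convex
quadratic. Convergence then follows, at a linear rate, from contraction and finiteness alone.

Let `x_S` be the minimizer of `f` over `C_S`. An iterate `v (k + 1)` lying in `C_S` is the projection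
onto `C_S` of the gradient step from `v k`, and as `C_S` is convex this step contracts towards `x_S`:
`‖v (k + 1) - x_S‖ ≤ r ‖v k - x_S‖` with `r < 1` independent of `S`
(`norm_sub_sq_le_of_projGrad`). So the distance from `v k` to `x_S` is at most
`‖v (k + 1) - v k‖ / (1 - r)`. These differences tend to zero, because a step length below the
inverse of the spectral norm gives sufficient decrease of `f` over `Ω`, convex or not
(`quad_descent`), and `f` is bounded below. Hence the points `x_S` selected at consecutive steps
become arbitrarily close, and, being finitely many, eventually agree
(`eventually_const_of_finite_of_tendsto`). From then on every step contracts towards one point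
`x`, which gives `‖v k - x‖ = O(r ^ k)` (`exists_limit_of_projGrad`).

The limit `x` is a fixed point of the proximal step. Any feasible `u` close to `x` has a support
containing that of `x`, so the segment from `x` to `u` is feasible, the fixed point satisfies
`⟪∇f x, u - x⟫ ≥ 0`, and convexity yields local optimality (`isLocallyOptimal_of_fixedPoint`). At
`x = 0` the same inequality would hold for every feasible `u`, and fails for one of positive mean
return (`ne_zero_of_fixedPoint`). Finally `f`, the normalization and the Sharpe ratio are
differentiable at the points in question, so they inherit the geometric rate, which is faster than the
rates `1 / k` and `1 / √k`.
-/

namespace SparseSharpe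

/-! ### Quadratic functions on a Hilbert space -/

section Quadratic

variable {E : Type*} [NormedAddCommGroup E] [InnerProductSpace ℝ E]

local notation "⟪" x ", " y "⟫" => inner ℝ x y

/-- The quadratic function `v ↦ ½ ⟪A v, v⟫ - ⟪b, v⟫`. -/
noncomputable def quad (A : E →L[ℝ] E) (b v : E) : ℝ := 1 / 2 * ⟪A v, v⟫ - ⟪b, v⟫

variable {A : E →L[ℝ] E} {b : E}

theorem quad_add (hA : (A : E →ₗ[ℝ] E).IsSymmetric) (x d : E) :
    quad A b (x + d) = quad A b x + ⟪A x - b, d⟫ + 1 / 2 * ⟪A d, d⟫ := by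
  have h : ⟪A d, x⟫ = ⟪A x, d⟫ := by rw [real_inner_comm]; exact (hA x d).symm
  simp only [quad, map_add, inner_add_left, inner_add_right, inner_sub_left, h]
  ring

theorem hasGradientAt_quad [CompleteSpace E] (hA : (A : E →ₗ[ℝ] E).IsSymmetric) (x : E) :
    HasGradientAt (quad A b) (A x - b) x := by
  have h := (((A.hasFDerivAt (x := x)).inner ℝ (hasFDerivAt_id x)).const_mul (1 / 2)).sub
    ((innerSL ℝ b).hasFDerivAt (x := x))
  rw [hasGradientAt_iff_hasFDerivAt]
  refine h.congr_fderiv ?_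
  ext d
  have h : ⟪A d, x⟫ = ⟪A x, d⟫ := by rw [real_inner_comm]; exact (hA x d).symm
  simp [h]
  ring

theorem gradient_quad [CompleteSpace E] (hA : (A : E →ₗ[ℝ] E).IsSymmetric) (x : E) :
    gradient (quad A b) x = A x - b :=
  (hasGradientAt_quad hA x).gradient

theorem continuous_quad : Continuous (quad A b) := by
  unfold quad
  fun_prop

theorem le_quad {ε : ℝ} (hlow : ∀ x, ε * ‖x‖ ^ 2 ≤ ⟪A x, x⟫) (x : E) :
    ε / 2 * ‖x‖ ^ 2 - ‖b‖ * ‖x‖ ≤ quad A b x := by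
  have h := hlow x
  have h' := real_inner_le_norm b x
  unfold quad
  linarith

theorem bddBelow_range_quad {ε : ℝ} (hε : 0 < ε) (hlow : ∀ x, ε * ‖x‖ ^ 2 ≤ ⟪A x, x⟫) :
    BddBelow (Set.range (quad A b)) := by
  refine ⟨-(‖b‖ ^ 2 / (2 * ε)), ?_⟩
  rintro _ ⟨x, rfl⟩
  refine le_trans ?_ (le_quad hlow x)
  have h : ε / 2 * ‖x‖ ^ 2 - ‖b‖ * ‖x‖ + ‖b‖ ^ 2 / (2 * ε) = (ε * ‖x‖ - ‖b‖) ^ 2 / (2 * ε) := by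
    field_simp
    ring
  have : 0 ≤ (ε * ‖x‖ - ‖b‖) ^ 2 / (2 * ε) := by positivity
  linarith

/-- A coercive quadratic function attains its minimum on a closed set. -/
theorem exists_isMinOn_quad [FiniteDimensional ℝ E] {ε : ℝ} (hε : 0 < ε)
    (hlow : ∀ x, ε * ‖x‖ ^ 2 ≤ ⟪A x, x⟫) {C : Set E} (hC : IsClosed C) (hne : C.Nonempty) :
    ∃ x ∈ C, IsMinOn (quad A b) C x := by
  have htop : Tendsto (quad A b) (cocompact E) atTop := by
    have h : Tendsto (fun t : ℝ => t * (ε / 2 * t - ‖b‖)) atTop atTop :=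
      tendsto_id.atTop_mul_atTop₀
        (tendsto_atTop_add_const_right _ _ (tendsto_id.const_mul_atTop (half_pos hε)))
    refine tendsto_atTop_mono (fun x => ?_) (h.comp (tendsto_norm_cocompact_atTop (E := E)))
    have := le_quad (b := b) hlow x
    simp only [Function.comp_apply]
    linarith
  obtain ⟨x₀, hx₀⟩ := hne
  exact continuous_quad.continuousOn.exists_isMinOn' hC hx₀
    ((htop.eventually_ge_atTop _).filter_mono inf_le_left)

/-- A linear term that is nonnegative up to a quadratic error along a segment is nonnegative. -/
theorem nonneg_of_forall_mul_add_sq_nonneg {a c : ℝ}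
    (h : ∀ t : ℝ, 0 < t → t ≤ 1 → 0 ≤ t * a + t ^ 2 * c) : 0 ≤ a := by
  have hlim : Tendsto (fun t : ℝ => a + t * c) (𝓝[>] 0) (𝓝 (a + 0 * c)) :=
    ((continuous_const.add (continuous_id.mul continuous_const)).tendsto 0).mono_left
      nhdsWithin_le_nhds
  rw [zero_mul, add_zero] at hlim
  refine ge_of_tendsto hlim ?_
  filter_upwards [Ioc_mem_nhdsGT (zero_lt_one' ℝ)] with t ht
  have := h t ht.1 ht.2
  have h2 : 0 ≤ t * (a + t * c) := by linarith
  exact nonneg_of_mul_nonneg_right h2 ht.1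

/-- First-order optimality condition for `quad A b` in the direction of a feasible segment. -/
theorem inner_nonneg_of_isMinOn_quad (hA : (A : E →ₗ[ℝ] E).IsSymmetric) {C : Set E} {x y : E}
    (hmin : IsMinOn (quad A b) C x)
    (hseg : ∀ t : ℝ, 0 < t → t ≤ 1 → x + t • (y - x) ∈ C) : 0 ≤ ⟪A x - b, y - x⟫ := by
  refine nonneg_of_forall_mul_add_sq_nonneg (c := 1 / 2 * ⟪A (y - x), y - x⟫) fun t h0 h1 => ?_
  have h : quad A b x ≤ quad A b (x + t • (y - x)) := hmin (hseg t h0 h1)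
  rw [quad_add hA, map_smul, inner_smul_left, inner_smul_right, inner_smul_right] at h
  simp only [conj_trivial] at h
  linarith

/-- Variational inequality for a nearest point in the direction of a feasible segment. -/
theorem inner_nonneg_of_forall_norm_le {C : Set E} {x y z : E}
    (hmin : ∀ u ∈ C, ‖x - z‖ ≤ ‖u - z‖)
    (hseg : ∀ t : ℝ, 0 < t → t ≤ 1 → x + t • (y - x) ∈ C) : 0 ≤ ⟪x - z, y - x⟫ := by
  suffices 0 ≤ 2 * ⟪x - z, y - x⟫ by linarith
  refine nonneg_of_forall_mul_add_sq_nonneg (c := ‖y - x‖ ^ 2) fun t h0 h1 => ?_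
  have h := hmin _ (hseg t h0 h1)
  have h2 := pow_le_pow_left₀ (norm_nonneg _) h 2
  have e : x + t • (y - x) - z = (x - z) + t • (y - x) := by abel
  rw [e, norm_add_sq_real, inner_smul_right, norm_smul, mul_pow, Real.norm_eq_abs, sq_abs] at h2
  linarith

/-! ### One step of the projected gradient method -/

/-- Sufficient decrease of `quad A b` along a projected gradient step; the set projected onto need
not be convex. -/
theorem quad_descent (hA : (A : E →ₗ[ℝ] E).IsSymmetric) {L α : ℝ} (hα : 0 < α)
    (hup : ∀ x, ⟪A x, x⟫ ≤ L * ‖x‖ ^ 2) {u v : E}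
    (hmin : ‖u - (v - α • (A v - b))‖ ≤ ‖v - (v - α • (A v - b))‖) :
    quad A b u + (1 / α - L) / 2 * ‖u - v‖ ^ 2 ≤ quad A b v := by
  have h2 := pow_le_pow_left₀ (norm_nonneg _) hmin 2
  have e1 : u - (v - α • (A v - b)) = (u - v) + α • (A v - b) := by abel
  have e2 : v - (v - α • (A v - b)) = α • (A v - b) := by abel
  rw [e1, e2, norm_add_sq_real, inner_smul_right, real_inner_comm] at h2
  have h3 := quad_add (b := b) hA v (u - v)
  rw [add_sub_cancel] at h3
  have h4 := hup (u - v)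
  have h5 : ⟪A v - b, u - v⟫ ≤ -(1 / α / 2 * ‖u - v‖ ^ 2) := by
    have : α * (⟪A v - b, u - v⟫ + 1 / α / 2 * ‖u - v‖ ^ 2) ≤ 0 := by
      have e : α * (⟪A v - b, u - v⟫ + 1 / α / 2 * ‖u - v‖ ^ 2)
          = α * ⟪A v - b, u - v⟫ + 1 / 2 * ‖u - v‖ ^ 2 := by field_simp
      linarith
    linarith [nonpos_of_mul_nonpos_right this hα]
  linarith

/-- A projected gradient step towards a convex set contracts towards the constrained minimizer. -/
theorem norm_sub_sq_le_of_projGrad (hA : (A : E →ₗ[ℝ] E).IsSymmetric) {ε α : ℝ} (hα : 0 < α)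
    (hε : 0 < ε) (hlow : ∀ x, ε * ‖x‖ ^ 2 ≤ ⟪A x, x⟫) (hup : ∀ x, α * ⟪A x, x⟫ ≤ ‖x‖ ^ 2)
    {C : Set E} (hC : Convex ℝ C) {u v x : E} (hu : u ∈ C)
    (hmin : ∀ y ∈ C, ‖u - (v - α • (A v - b))‖ ≤ ‖y - (v - α • (A v - b))‖)
    (hx : x ∈ C) (hxmin : IsMinOn (quad A b) C x) :
    (1 + α * ε) * ‖u - x‖ ^ 2 ≤ ‖v - x‖ ^ 2 := by
  have h1 := inner_nonneg_of_forall_norm_le hmin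
    fun t h0 h1 => hC.add_smul_sub_mem hu hx ⟨h0.le, h1⟩
  have h2 := mul_nonneg hα.le <| inner_nonneg_of_isMinOn_quad hA hxmin
    fun t h0 h1 => hC.add_smul_sub_mem hx hu ⟨h0.le, h1⟩
  obtain ⟨d, rfl⟩ : ∃ d, v = x + d := ⟨v - x, by abel⟩
  obtain ⟨e, rfl⟩ : ∃ e, u = x + e := ⟨u - x, by abel⟩
  have e1 : x + e - (x + d - α • (A (x + d) - b)) = e - d + α • A d + α • (A x - b) := by
    rw [map_add]; module
  have e2 : x - (x + e) = -e := by abel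
  rw [e1, e2] at h1
  rw [add_sub_cancel_left] at h2 ⊢
  rw [add_sub_cancel_left]
  -- `⟪(1 - α A) (d - e), d - e⟫ ≥ 0` and `⟪(1 - α A) z, z⟫ ≤ (1 - α ε) ‖z‖²` for `z = d, e`
  have h3 := hup (d - e)
  have h4 := mul_le_mul_of_nonneg_left (hlow d) hα.le
  have h5 := mul_le_mul_of_nonneg_left (hlow e) hα.le
  have h6 : ⟪A e, d⟫ = ⟪A d, e⟫ := by rw [real_inner_comm]; exact (hA d e).symm
  rw [map_sub, norm_sub_sq_real] at h3
  simp only [inner_neg_right, inner_add_left, inner_sub_left, inner_sub_right, inner_smul_left,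
    conj_trivial, h6, real_inner_self_eq_norm_sq] at h1 h2 h3
  have h7 : 0 ≤ α * ε * ‖d‖ ^ 2 := by positivity
  nlinarith

/-! ### Convergence over a finite union of convex sets -/

/-- A sequence with values in a finite set whose successive distances tend to zero is eventually
constant. -/
theorem eventually_const_of_finite_of_tendsto {X : Type*} [MetricSpace X] {ι : Type*}
    [Finite ι] (x : ι → X) (i : ℕ → ι)
    (h : Tendsto (fun k => dist (x (i (k + 1))) (x (i k))) atTop (𝓝 0)) :
    ∃ j, ∀ᶠ k in atTop, x (i k) = x j := by
  have h1 : ∀ a b, ∀ᶠ k in atTop, x a ≠ x b → dist (x (i (k + 1))) (x (i k)) < dist (x a) (x b) := by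
    intro a b
    by_cases hab : x a = x b
    · simp [hab]
    · filter_upwards [h.eventually_lt_const (dist_pos.2 hab)] with k hk _ using hk
  have h2 := eventually_all.2 fun a => eventually_all.2 (h1 a)
  obtain ⟨K, hK⟩ := eventually_atTop.1 h2
  refine ⟨i K, eventually_atTop.2 ⟨K, fun k hk => ?_⟩⟩
  induction k, hk using Nat.le_induction with
  | base => rfl
  | succ k hk ih =>
    rw [← ih]
    by_contra hne
    exact lt_irrefl _ (hK k hk _ _ hne)

theorem isBigO_pow_of_eventually_le_mul {a : ℕ → ℝ} {r : ℝ} (hr : 0 < r) (ha : ∀ k, 0 ≤ a k)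
    (h : ∀ᶠ k in atTop, a (k + 1) ≤ r * a k) : a =O[atTop] fun k => r ^ k := by
  obtain ⟨K, hK⟩ := eventually_atTop.1 h
  refine IsBigO.of_bound (a K / r ^ K) (eventually_atTop.2 ⟨K, fun k hk => ?_⟩)
  rw [Real.norm_of_nonneg (ha k), Real.norm_of_nonneg (by positivity)]
  induction k, hk using Nat.le_induction with
  | base => rw [div_mul_cancel₀ _ (by positivity)]
  | succ k hk ih =>
    calc a (k + 1) ≤ r * a k := hK k hk
      _ ≤ r * (a K / r ^ K * r ^ k) := by gcongr
      _ = a K / r ^ K * r ^ (k + 1) := by ring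

/-- Monotone convergence of `f` makes its decrements, hence also the step lengths `a`, vanish. -/
theorem tendsto_zero_of_descent {f a : ℕ → ℝ} {c : ℝ} (hc : 0 < c) (hf : BddBelow (Set.range f))
    (ha : ∀ k, 0 ≤ a k) (h : ∀ k, f (k + 1) + c * a k ^ 2 ≤ f k) : Tendsto a atTop (𝓝 0) := by
  have hanti : Antitone f := antitone_nat_of_succ_le fun k => by
    have := mul_nonneg hc.le (sq_nonneg (a k))
    linarith [h k]
  have hlim := tendsto_atTop_ciInf hanti hf
  have hd : Tendsto (fun k => √((f k - f (k + 1)) / c)) atTop (𝓝 0) := by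
    have := ((hlim.sub ((tendsto_add_atTop_iff_nat 1).2 hlim)).div_const c).sqrt
    simpa using this
  refine squeeze_zero ha (fun k => Real.le_sqrt_of_sq_le ?_) hd
  rw [le_div_iff₀ hc]
  linarith [h k]

/-- **Linear convergence of the projected gradient method over a finite union of convex sets.**
Successive differences tend to zero by sufficient decrease. Each iterate is a projected gradient
step onto one of the pieces, so the previous iterate is close to the minimizer over that piece;
as there are finitely many minimizers, the same one is eventually approached at every step. -/
theorem exists_limit_of_projGrad [FiniteDimensional ℝ E] (hA : (A : E →ₗ[ℝ] E).IsSymmetric)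
    {ε L α : ℝ} (hα : 0 < α) (hε : 0 < ε) (hαL : α * L < 1)
    (hlow : ∀ x, ε * ‖x‖ ^ 2 ≤ ⟪A x, x⟫) (hup : ∀ x, ⟪A x, x⟫ ≤ L * ‖x‖ ^ 2)
    {ι : Type*} [Finite ι] {C : ι → Set E} (hconv : ∀ i, Convex ℝ (C i))
    (hclosed : ∀ i, IsClosed (C i)) {v : ℕ → E} (hv : ∀ k, v (k + 1) ∈ ⋃ i, C i)
    (hmin : ∀ k, ∀ u ∈ ⋃ i, C i, ‖v (k + 1) - (v k - α • (A (v k) - b))‖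
      ≤ ‖u - (v k - α • (A (v k) - b))‖) :
    ∃ i, ∃ x ∈ C i, ∃ r : ℝ, 0 < r ∧ r < 1 ∧ (fun k => ‖v k - x‖) =O[atTop] fun k => r ^ k := by
  have hup' : ∀ x, α * ⟪A x, x⟫ ≤ ‖x‖ ^ 2 := fun x => by
    have h1 := mul_le_mul_of_nonneg_left (hup x) hα.le
    have h2 := mul_le_mul_of_nonneg_right hαL.le (sq_nonneg ‖x‖)
    linarith
  have hdiff : Tendsto (fun k => ‖v (k + 1) - v k‖) atTop (𝓝 0) := by
    -- `v 0` need not be feasible, so the decrease is only available from `v 1` on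
    refine (tendsto_add_atTop_iff_nat 1).1 ?_
    have hc : 0 < (1 / α - L) / 2 := by
      have : L < 1 / α := by rw [lt_div_iff₀ hα]; linarith
      linarith
    refine tendsto_zero_of_descent (f := fun k => quad A b (v (k + 1))) hc
      ((bddBelow_range_quad (b := b) hε hlow).mono ?_) (fun _ => norm_nonneg _)
      fun k => quad_descent hA hα hup (hmin _ _ (hv k))
    rintro _ ⟨k, rfl⟩
    exact ⟨_, rfl⟩
  choose i hi using fun k => Set.mem_iUnion.1 (hv k)
  -- only the pieces that contain some iterate are known to be nonempty
  have hx : ∀ j, ∃ x, (C j).Nonempty → x ∈ C j ∧ IsMinOn (quad A b) (C j) x := fun j => by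
    by_cases hj : (C j).Nonempty
    · obtain ⟨x, h1, h2⟩ := exists_isMinOn_quad (b := b) hε hlow (hclosed j) hj
      exact ⟨x, fun _ => ⟨h1, h2⟩⟩
    · exact ⟨0, fun h => absurd h hj⟩
  choose x hx using hx
  have hxk : ∀ k, x (i k) ∈ C (i k) ∧ IsMinOn (quad A b) (C (i k)) (x (i k)) :=
    fun k => hx _ ⟨_, hi k⟩
  set s := 1 + α * ε with hs
  have hs1 : 1 < s := by have := mul_pos hα hε; linarith
  obtain ⟨r, hr⟩ : ∃ r, r = (√s)⁻¹ := ⟨_, rfl⟩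
  have hs0 : 0 < √s := Real.sqrt_pos.2 (by linarith)
  have hr0 : 0 < r := hr ▸ inv_pos.2 hs0
  have hr1 : r < 1 := by
    rw [hr]
    exact inv_lt_one_of_one_lt₀ (Real.lt_sqrt_of_sq_lt (by linarith))
  have hcontr : ∀ k, ‖v (k + 1) - x (i k)‖ ≤ r * ‖v k - x (i k)‖ := fun k => by
    have h := norm_sub_sq_le_of_projGrad hA hα hε hlow hup' (hconv (i k)) (hi k)
      (fun y hy => hmin k y (Set.mem_iUnion.2 ⟨_, hy⟩)) (hxk k).1 (hxk k).2
    rw [hr, inv_mul_eq_div, le_div_iff₀ hs0]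
    refine le_of_sq_le_sq ?_ (norm_nonneg _)
    rw [mul_pow, Real.sq_sqrt (by linarith)]
    linarith
  have hnear : Tendsto (fun k => ‖v k - x (i k)‖) atTop (𝓝 0) := by
    have h := hdiff.const_mul (1 - r)⁻¹
    rw [mul_zero] at h
    refine squeeze_zero (fun _ => norm_nonneg _) (fun k => ?_) h
    rw [inv_mul_eq_div, le_div_iff₀ (by linarith)]
    have h1 := norm_sub_le_norm_sub_add_norm_sub (v k) (v (k + 1)) (x (i k))
    rw [norm_sub_rev (v k) (v (k + 1))] at h1
    linarith [hcontr k]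
  obtain ⟨j, hj⟩ := eventually_const_of_finite_of_tendsto x i
    (by
      have h := (((tendsto_add_atTop_iff_nat 1).2 hnear).add hdiff).add hnear
      simp only [add_zero] at h
      refine squeeze_zero (fun _ => dist_nonneg) (fun k => ?_) h
      rw [dist_eq_norm]
      have e : x (i (k + 1)) - x (i k)
        = -(v (k + 1) - x (i (k + 1))) + (v (k + 1) - v k) + (v k - x (i k)) := by abel
      rw [e]
      refine (norm_add₃_le).trans ?_
      rw [norm_neg])
  obtain ⟨k, hk⟩ := hj.exists
  refine ⟨i k, x (i k), (hxk k).1, r, hr0, hr1, ?_⟩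
  refine isBigO_pow_of_eventually_le_mul hr0 (fun _ => norm_nonneg _) ?_
  filter_upwards [hj] with l hl
  have := hcontr l
  rwa [hl, ← hk] at this

end Quadratic

/-! ### The regularized covariance operator -/

section Covariance

variable {T N : ℕ} (R : Matrix (Fin T) (Fin N) ℝ) (ε : ℝ)

/-- The regularized covariance matrix as an operator on Euclidean space. -/
noncomputable def covOp : EuclideanSpace ℝ (Fin N) →L[ℝ] EuclideanSpace ℝ (Fin N) :=
  Matrix.toEuclideanCLM (𝕜 := ℝ) (covReg R ε)

theorem inner_covOp (x y : EuclideanSpace ℝ (Fin N)) :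
    inner ℝ (covOp R ε y) x = x.ofLp ⬝ᵥ (covReg R ε *ᵥ y.ofLp) := by
  rw [real_inner_comm]
  exact Matrix.inner_toEuclideanCLM _ _ _

theorem inner_meanReturn (x : EuclideanSpace ℝ (Fin N)) :
    inner ℝ (WithLp.toLp 2 (meanReturn R)) x = meanReturn R ⬝ᵥ x.ofLp := by
  rw [real_inner_comm, EuclideanSpace.inner_eq_star_dotProduct, star_trivial]

theorem objective_eq_quad :
    objective R ε = quad (covOp R ε) (WithLp.toLp 2 (meanReturn R)) := by
  ext v
  rw [quad, inner_covOp, inner_meanReturn, objective]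

theorem sharpe_eq (w : EuclideanSpace ℝ (Fin N)) :
    sharpe R ε w =
      inner ℝ (WithLp.toLp 2 (meanReturn R)) w / √(inner ℝ (covOp R ε w) w) := by
  rw [inner_covOp, inner_meanReturn, sharpe]

theorem covReg_transpose : (covReg R ε)ᵀ = covReg R ε := by
  simp [covReg]

theorem covOp_isSymmetric :
    (covOp R ε : EuclideanSpace ℝ (Fin N) →ₗ[ℝ] EuclideanSpace ℝ (Fin N)).IsSymmetric := by
  intro x y
  change inner ℝ (covOp R ε x) y = inner ℝ x (covOp R ε y)
  rw [inner_covOp, real_inner_comm, inner_covOp, Matrix.dotProduct_mulVec,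
    ← Matrix.mulVec_transpose, covReg_transpose, dotProduct_comm]

theorem le_inner_covOp (x : EuclideanSpace ℝ (Fin N)) :
    ε * ‖x‖ ^ 2 ≤ inner ℝ (covOp R ε x) x := by
  have h : ‖x‖ ^ 2 = x.ofLp ⬝ᵥ x.ofLp := by
    rw [← real_inner_self_eq_norm_sq, EuclideanSpace.inner_eq_star_dotProduct, star_trivial]
  rw [inner_covOp, covReg, Matrix.add_mulVec, dotProduct_add, Matrix.smul_mulVec,
    Matrix.one_mulVec, dotProduct_smul, h, smul_eq_mul, ← Matrix.mulVec_mulVec,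
    Matrix.dotProduct_mulVec, Matrix.vecMul_transpose]
  have : 0 ≤ (centered R *ᵥ x.ofLp) ⬝ᵥ (centered R *ᵥ x.ofLp) :=
    Finset.sum_nonneg fun i _ => mul_self_nonneg _
  linarith

theorem inner_covOp_le (x : EuclideanSpace ℝ (Fin N)) :
    inner ℝ (covOp R ε x) x ≤ spectralNorm (covReg R ε) * ‖x‖ ^ 2 := by
  refine (real_inner_le_norm _ _).trans ?_
  rw [sq, ← mul_assoc]
  exact mul_le_mul_of_nonneg_right ((covOp R ε).le_opNorm x) (norm_nonneg _)

theorem differentiableAt_sharpe {ε : ℝ} (hε : 0 < ε) {w : EuclideanSpace ℝ (Fin N)} (hw : w ≠ 0) :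
    DifferentiableAt ℝ (sharpe R ε) w := by
  have hpos : 0 < inner ℝ (covOp R ε w) w := by
    have := norm_pos_iff.2 hw
    exact lt_of_lt_of_le (by positivity) (le_inner_covOp R ε w)
  have hinner : DifferentiableAt ℝ
      (fun w => inner ℝ (covOp R ε w) w) w :=
    (covOp R ε).differentiableAt.inner ℝ differentiableAt_id
  simp only [funext (sharpe_eq R ε), div_eq_mul_inv]
  exact ((differentiableAt_const _).inner ℝ differentiableAt_id).fun_mul
    ((hinner.sqrt hpos.ne').fun_inv (Real.sqrt_pos.2 hpos).ne')

end Covariance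

/-! ### Nonnegative sparse vectors -/

section Feasible

variable {N m : ℕ}

/-- The cone of nonnegative vectors supported in `S`. -/
def suppCone (S : Finset (Fin N)) : Set (EuclideanSpace ℝ (Fin N)) :=
  {v | ∀ i, 0 ≤ v i ∧ (i ∉ S → v i = 0)}

theorem convex_suppCone (S : Finset (Fin N)) : Convex ℝ (suppCone S) := by
  intro x hx y hy a b ha hb _ i
  refine ⟨?_, fun hi => ?_⟩
  · simpa using add_nonneg (mul_nonneg ha (hx i).1) (mul_nonneg hb (hy i).1)
  · simp [(hx i).2 hi, (hy i).2 hi]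

theorem isClosed_suppCone (S : Finset (Fin N)) : IsClosed (suppCone S) := by
  have h : suppCone S = ⋂ i, {v : EuclideanSpace ℝ (Fin N) | 0 ≤ v i ∧ (i ∉ S → v i = 0)} := by
    ext v
    simp [suppCone]
  rw [h]
  refine isClosed_iInter fun i => ?_
  have hcont : Continuous fun v : EuclideanSpace ℝ (Fin N) => v i := by fun_prop
  refine (isClosed_le continuous_const hcont).and ?_
  by_cases hi : i ∈ S
  · simp [hi]
  · simpa [hi] using isClosed_eq hcont continuous_const

theorem feasible_eq_iUnion :
    feasible N m = ⋃ S : {S : Finset (Fin N) // S.card ≤ m}, suppCone S.1 := by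
  ext v
  rw [Set.mem_iUnion]
  constructor
  · rintro ⟨h0, hm⟩
    exact ⟨⟨_, hm⟩, fun i => ⟨h0 i, fun hi => by simpa using hi⟩⟩
  · rintro ⟨⟨S, hS⟩, hv⟩
    refine ⟨fun i => (hv i).1, (Finset.card_le_card fun i hi => ?_).trans hS⟩
    by_contra hiS
    exact (Finset.mem_filter.1 hi).2 ((hv i).2 hiS)

/-- Segments that start at a vector whose support lies in that of the endpoint stay feasible. -/
theorem add_smul_sub_mem_feasible {x u : EuclideanSpace ℝ (Fin N)} (hx : ∀ i, 0 ≤ x i)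
    (hu : u ∈ feasible N m) (hsupp : ∀ i, u i = 0 → x i = 0) {t : ℝ} (h0 : 0 ≤ t) (h1 : t ≤ 1) :
    x + t • (u - x) ∈ feasible N m := by
  rw [feasible_eq_iUnion, Set.mem_iUnion]
  refine ⟨⟨_, hu.2⟩, (convex_suppCone _).add_smul_sub_mem ?_ ?_ ⟨h0, h1⟩⟩
  · exact fun i => ⟨hx i, fun hi => hsupp i (by simpa using hi)⟩
  · exact fun i => ⟨hu.1 i, fun hi => by simpa using hi⟩

theorem eventually_support_subset (x : EuclideanSpace ℝ (Fin N)) :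
    ∀ᶠ u in 𝓝 x, ∀ i, u i = 0 → x i = 0 := by
  refine eventually_all.2 fun i => ?_
  by_cases hi : x i = 0
  · simp [hi]
  · have hcont : Continuous fun v : EuclideanSpace ℝ (Fin N) => v i := by fun_prop
    filter_upwards [hcont.continuousAt.eventually_ne hi] with u hu h using absurd h hu

theorem mem_prox_iota {C : Set (EuclideanSpace ℝ (Fin N))} (hC : C.Nonempty)
    {h x : EuclideanSpace ℝ (Fin N)} :
    h ∈ prox (iota C) x ↔ h ∈ C ∧ ∀ u ∈ C, ‖h - x‖ ≤ ‖u - x‖ := by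
  have key : ∀ a b : EuclideanSpace ℝ (Fin N),
      1 / 2 * ‖a‖ ^ 2 ≤ 1 / 2 * ‖b‖ ^ 2 ↔ ‖a‖ ≤ ‖b‖ := fun a b => by
    rw [mul_le_mul_iff_right₀ (by norm_num), sq_le_sq₀ (norm_nonneg _) (norm_nonneg _)]
  constructor
  · intro hh
    have hmem : h ∈ C := by
      by_contra hn
      obtain ⟨u, hu⟩ := hC
      have := hh u
      rw [iota, iota, if_neg hn, if_pos hu, EReal.coe_add_top, add_zero, top_le_iff] at this
      exact EReal.coe_ne_top _ this
    refine ⟨hmem, fun u hu => ?_⟩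
    have := hh u
    rw [iota, iota, if_pos hmem, if_pos hu, add_zero, add_zero, EReal.coe_le_coe_iff] at this
    exact (key _ _).1 this
  · rintro ⟨hmem, hmin⟩ u
    by_cases hu : u ∈ C
    · rw [iota, iota, if_pos hmem, if_pos hu, add_zero, add_zero, EReal.coe_le_coe_iff]
      exact (key _ _).2 (hmin u hu)
    · rw [iota, iota, if_neg hu, EReal.coe_add_top]
      exact le_top

/-- The case distinction in `normalize` agrees with division by zero being zero. -/
theorem normalize_eq (v : EuclideanSpace ℝ (Fin N)) : normalize v = (1 / ∑ i, v i) • v := by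
  rw [normalize]
  split_ifs with h
  · rfl
  · rw [not_not.1 h, div_zero, zero_smul]

theorem differentiableAt_normalize {v : EuclideanSpace ℝ (Fin N)} (hv : ∑ i, v i ≠ 0) :
    DifferentiableAt ℝ normalize v := by
  rw [funext normalize_eq]
  have h : DifferentiableAt ℝ (fun v : EuclideanSpace ℝ (Fin N) => ∑ i, v i) v := by fun_prop
  fun_prop (disch := exact hv)

end Feasible

/-! ### Fixed points of the proximal gradient step -/

section FixedPoint

variable {T N m : ℕ} {R : Matrix (Fin T) (Fin N) ℝ} {ε : ℝ}

/-- Feasible vectors close to `x` have a support containing that of `x`, so the segments joining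
them to `x` are feasible, and a fixed point satisfies the variational inequality along them. -/
theorem isLocallyOptimal_of_fixedPoint (hε : 0 < ε) {α : ℝ} (hα : 0 < α)
    {x : EuclideanSpace ℝ (Fin N)}
    (hx : x ∈ prox (iota (feasible N m)) (x - α • gradient (objective R ε) x))
    (hf : x ∈ feasible N m) :
    IsLocallyOptimal R ε m x := by
  refine ⟨hf, ?_⟩
  have hA := covOp_isSymmetric R ε
  rw [mem_prox_iota ⟨x, hf⟩, objective_eq_quad, gradient_quad hA] at hx
  filter_upwards [nhdsWithin_le_nhds (eventually_support_subset x), self_mem_nhdsWithin]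
    with u hsupp hu
  have h := inner_nonneg_of_forall_norm_le (y := u) hx.2
    fun t h0 h1 => add_smul_sub_mem_feasible hf.1 hu hsupp h0.le h1
  rw [sub_sub_cancel, real_inner_smul_left] at h
  have h' := nonneg_of_mul_nonneg_right h hα
  have hq := quad_add (b := WithLp.toLp 2 (meanReturn R)) hA x (u - x)
  rw [add_sub_cancel] at hq
  have hpos := (mul_nonneg hε.le (sq_nonneg ‖u - x‖)).trans (le_inner_covOp R ε (u - x))
  rw [objective_eq_quad]
  linarith

/-- At the origin the gradient is minus the mean return, so a feasible `w` of positive mean return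
is a feasible descent direction there. -/
theorem ne_zero_of_fixedPoint {α : ℝ} (hα : 0 < α)
    (hpos : ∃ w ∈ feasible N m, 0 < meanReturn R ⬝ᵥ w.ofLp) {x : EuclideanSpace ℝ (Fin N)}
    (hx : x ∈ prox (iota (feasible N m)) (x - α • gradient (objective R ε) x)) : x ≠ 0 := by
  rintro rfl
  obtain ⟨w, hw, hpw⟩ := hpos
  rw [mem_prox_iota ⟨w, hw⟩, objective_eq_quad, gradient_quad (covOp_isSymmetric R ε)] at hx
  have h := inner_nonneg_of_forall_norm_le (y := w) hx.2
    fun t h0 h1 => add_smul_sub_mem_feasible (by simp) hw (by simp) h0.le h1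
  rw [sub_sub_cancel, real_inner_smul_left, map_zero, zero_sub, sub_zero, inner_neg_left,
    inner_meanReturn] at h
  have := nonneg_of_mul_nonneg_right h hα
  linarith

/-- Limits of the iterates are fixed points: the minimality of each iterate passes to the limit
because the gradient is continuous. -/
theorem fixedPoint_of_tendsto {α : ℝ} {v : ℕ → EuclideanSpace ℝ (Fin N)} (hv : IsPGA R ε m α v)
    {x : EuclideanSpace ℝ (Fin N)} (hlim : Tendsto v atTop (𝓝 x)) (hf : x ∈ feasible N m) :
    x ∈ prox (iota (feasible N m)) (x - α • gradient (objective R ε) x) := by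
  have hcont : Continuous fun y => y - α • gradient (objective R ε) y := by
    rw [objective_eq_quad, funext (gradient_quad (covOp_isSymmetric R ε))]
    fun_prop
  have hstep := (hcont.tendsto x).comp hlim
  refine (mem_prox_iota ⟨x, hf⟩).2 ⟨hf, fun u hu => ?_⟩
  exact le_of_tendsto_of_tendsto' (((tendsto_add_atTop_iff_nat 1).2 hlim).sub hstep).norm
    (tendsto_const_nhds.sub hstep).norm fun k => ((mem_prox_iota ⟨x, hf⟩).1 (hv k)).2 u hu

end FixedPoint

end SparseSharpe

/-! ### Comparison of rates -/

theorem Real.isBigO_pow_one_div_natCast {r : ℝ} (h0 : 0 ≤ r) (h1 : r < 1) :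
    (fun k : ℕ => r ^ k) =O[atTop] fun k : ℕ => 1 / (k : ℝ) := by
  refine IsBigO.of_bound 1 ?_
  filter_upwards [(tendsto_self_mul_const_pow_of_lt_one h0 h1).eventually_le_const one_pos,
    eventually_gt_atTop 0] with k hk hk0
  have : (0 : ℝ) < k := Nat.cast_pos.2 hk0
  rw [Real.norm_of_nonneg (by positivity), Real.norm_of_nonneg (by positivity), one_mul,
    le_div_iff₀ this]
  linarith

theorem Real.isBigO_one_div_natCast_one_div_sqrt :
    (fun k : ℕ => 1 / (k : ℝ)) =O[atTop] fun k : ℕ => 1 / √(k : ℝ) := by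
  refine IsBigO.of_bound 1 ?_
  filter_upwards [eventually_ge_atTop 1] with k hk
  have h1 : (1 : ℝ) ≤ k := Nat.one_le_cast.2 hk
  rw [Real.norm_of_nonneg (by positivity), Real.norm_of_nonneg (by positivity), one_mul]
  exact one_div_le_one_div_of_le (by positivity) ((Real.sqrt_le_left (by linarith)).2 (by nlinarith))

/-! ### Convergence of the iterates and of the normalized portfolios -/

theorem mainTheorem1 {T N : ℕ} (hT : 2 ≤ T) (m : ℕ)
    (R : Matrix (Fin T) (Fin N) ℝ) (ε : ℝ) (hε : 0 < ε)
    (hpos : ∃ w ∈ SparseSharpe.feasible N m, 0 < SparseSharpe.meanReturn R ⬝ᵥ w.ofLp)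
    (α : ℝ) (hα : α ∈ Set.Ioo 0 (1 / SparseSharpe.spectralNorm (SparseSharpe.covReg R ε)))
    (v : ℕ → EuclideanSpace ℝ (Fin N)) (hv : SparseSharpe.IsPGA R ε m α v)
    (w : ℕ → EuclideanSpace ℝ (Fin N)) (hw : ∀ k, w k = SparseSharpe.normalize (v k)) :
    ∃ vstar wstar : EuclideanSpace ℝ (Fin N),
      -- (i) convergence to a locally optimal solution, with rates
      (SparseSharpe.IsLocallyOptimal R ε m vstar ∧
        Tendsto v atTop (𝓝 vstar) ∧
        (fun k => ‖v k - vstar‖) =O[atTop] (fun k : ℕ => 1 / √(k : ℝ)) ∧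
        (fun k => |SparseSharpe.objective R ε (v k) - SparseSharpe.objective R ε vstar|)
          =O[atTop] (fun k : ℕ => 1 / (k : ℝ))) ∧
      -- (ii) the limit is nonnegative and nonzero
      ((∀ i, 0 ≤ vstar i) ∧ vstar ≠ 0) ∧
      -- (iii) convergence of the normalized portfolios, with rates
      (wstar = (1 / ∑ i, vstar i) • vstar ∧
        Tendsto w atTop (𝓝 wstar) ∧
        (fun k => ‖w k - wstar‖) =O[atTop] (fun k : ℕ => 1 / √(k : ℝ)) ∧
        (fun k => |SparseSharpe.sharpe R ε (w k) - SparseSharpe.sharpe R ε wstar|)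
          =O[atTop] (fun k : ℕ => 1 / √(k : ℝ))) := by
  open SparseSharpe in
  obtain ⟨hα0, hα1⟩ := hα
  have hne : (feasible N m).Nonempty := hpos.imp fun _ h => h.1
  have hA := covOp_isSymmetric R ε
  -- the step size interval is empty if the spectral norm is zero
  have hL : 0 < spectralNorm (covReg R ε) := one_div_pos.1 (hα0.trans hα1)
  have hstep : ∀ k, v (k + 1) ∈ feasible N m ∧ ∀ u ∈ feasible N m,
      ‖v (k + 1) - (v k - α • (covOp R ε (v k) - WithLp.toLp 2 (meanReturn R)))‖
        ≤ ‖u - (v k - α • (covOp R ε (v k) - WithLp.toLp 2 (meanReturn R)))‖ := fun k => by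
    rw [← gradient_quad hA, ← objective_eq_quad]
    exact (mem_prox_iota hne).1 (hv k)
  obtain ⟨S, x, hxS, r, hr0, hr1, hrate⟩ := exists_limit_of_projGrad hA hα0 hε
    ((lt_div_iff₀ hL).1 hα1) (le_inner_covOp R ε) (inner_covOp_le R ε)
    (fun S : {S : Finset (Fin N) // S.card ≤ m} => convex_suppCone S.1)
    (fun S => isClosed_suppCone S.1)
    (fun k => feasible_eq_iUnion ▸ (hstep k).1) (fun k => feasible_eq_iUnion ▸ (hstep k).2)
  have hxf : x ∈ feasible N m := feasible_eq_iUnion ▸ Set.mem_iUnion.2 ⟨S, hxS⟩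
  have hrate' : (fun k => v k - x) =O[atTop] fun k => r ^ k := hrate.of_norm_left
  have hlim : Tendsto v atTop (𝓝 x) := tendsto_sub_nhds_zero_iff.1
    (hrate'.trans_tendsto (tendsto_pow_atTop_nhds_zero_of_lt_one hr0.le hr1))
  have hfix := fixedPoint_of_tendsto hv hlim hxf
  have hx0 : x ≠ 0 := ne_zero_of_fixedPoint hα0 hpos hfix
  have hk := Real.isBigO_pow_one_div_natCast hr0.le hr1
  have hsqrt := hk.trans Real.isBigO_one_div_natCast_one_div_sqrt
  have hsum : ∑ i, x i ≠ 0 := fun h => hx0 <| by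
    ext i
    exact (Finset.sum_eq_zero_iff_of_nonneg fun i _ => hxf.1 i).1 h i (Finset.mem_univ i)
  have hdn := differentiableAt_normalize hsum
  have hwx : normalize x ≠ 0 := by
    rw [normalize_eq]
    exact smul_ne_zero (one_div_ne_zero hsum) hx0
  have hds := differentiableAt_sharpe R hε hwx
  have hdf : DifferentiableAt ℝ (objective R ε) x := by
    rw [objective_eq_quad]
    exact (hasGradientAt_quad hA x).differentiableAt
  obtain rfl : w = fun k => normalize (v k) := funext hw
  have hwlim : Tendsto (fun k => normalize (v k)) atTop (𝓝 (normalize x)) :=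
    hdn.continuousAt.tendsto.comp hlim
  have hwrate : (fun k => normalize (v k) - normalize x) =O[atTop] fun k => r ^ k :=
    (hdn.isBigO_sub.comp_tendsto hlim).trans hrate'
  refine ⟨x, normalize x, ⟨isLocallyOptimal_of_fixedPoint hε hα0 hfix hxf, hlim,
    (hrate'.trans hsqrt).norm_left, ?_⟩, ⟨hxf.1, hx0⟩, normalize_eq x, hwlim,
    (hwrate.trans hsqrt).norm_left, ?_⟩
  · exact (((hdf.isBigO_sub.comp_tendsto hlim).trans hrate').trans hk).norm_left
  · exact (((hds.isBigO_sub.comp_tendsto hwlim).trans hwrate).trans hsqrt).norm_left
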